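/- Let $(\Omega,\mathcal F,(\mathcal F_t)_{t\ge 0},\mathbb P)$ be a filtered probability space, $\mathbb P$ being the pricing measure, and let $W$ be a Brownian motion relative to $(\mathcal F_t)$ (that is, $W$ is an adapted Brownian motion and $W_t-W_s$ is independent of $\mathcal F_s$ for $s\le t$). Let $T\ge 0$, let the interest rate $r:[0,T]\to\mathbb R$ be deterministic and Lebesgue integrable, and let $0<t_1<\dots<t_n<T$ be deterministic ex-dividend dates with deterministic dividend values $D_1,\dots,D_n\in\mathbb R$ (where $n\ge 0$). Let the stock price $(S_t)_{0\le t\le T}$ be an adapted process with right-continuous paths with left limits and with $\mathbb E|S_0|<\infty$, which solves $$dS_t = S_t r_t\,dt + S_t\sigma_t\,dW_t + \mathcal J S_t,\qquad \mathcal J S_t = S_t-S_{t^-}=\begin{cases}-D_i & \text{if } t=t_i,\\ 0&\text{otherwise,}\end{cases}$$ that is, almost surely, for all $t\in[0,T]$, $$S_t = S_0+\int_0^t S_u r_u\,du+\int_0^t S_u\sigma_u\,dW_u+\sum_{i:\,t_i\le t}\mathcal J S_{t_i},$$ where $\sigma$ is a (possibly random) volatility process such that $S\sigma$ is adapted, jointly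 measurable up to null sets, and $\mathbb E\int_0^T (S_u\sigma_u)^2\,du<\infty$, and the second integral is the Itô integral (the $L^2$ limit of integrals of simple processes, in a version with continuous paths). Let $$I_t=\sum_{i=1}^n D_i\exp\Big(\int_{t_i}^t r_u\,du\Big)1_{[t_i,\infty)}(t)$$ be the money account into which the past dividends are reinvested. Then $S_T$ is integrable and, for every $t\in[0,T]$, the forward price is given almost surely by $$\mathbb E\left[S_T\mid\mathcal F_t\right]=e^{\int_t^T r_u\,du}\,(S_t+I_t)-I_T .$$ -/

import Mathlib

open MeasureTheory ProbabilityTheory Filter Topology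
open scoped NNReal ENNReal

noncomputable section

namespace DividendStock

variable {Ω : Type*} {mΩ : MeasurableSpace Ω}

/-- `W` is a Brownian motion relative to the filtration `ℱ`: it is a Brownian motion, it is
adapted, and for `s ≤ t` the increment `W t - W s` is independent of `ℱ s`. -/
structure IsBrownianWrt (P : Measure Ω) (ℱ : Filtration ℝ≥0 mΩ) (W : ℝ≥0 → Ω → ℝ) : Prop where
  isBrownian : IsBrownianReal W P
  adapted : StronglyAdapted ℱ W
  indep : ∀ s t : ℝ≥0, s ≤ t →
    Indep (MeasurableSpace.comap (fun ω => W t ω - W s ω) inferInstance) (ℱ s) P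

/-- A simple (elementary predictable) process `∑ j, ξ j * 1_(a j, b j]`, a finite sum in which
each `ξ j` is bounded and measurable with respect to `ℱ (a j)`. -/
structure SimpleProcess (ℱ : Filtration ℝ≥0 mΩ) where
  n : ℕ
  a : Fin n → ℝ≥0
  b : Fin n → ℝ≥0
  a_le_b : ∀ j, a j ≤ b j
  ξ : Fin n → Ω → ℝ
  measurable_ξ : ∀ j, StronglyMeasurable[ℱ (a j)] (ξ j)
  bounded_ξ : ∀ j, ∃ C : ℝ, ∀ ω, |ξ j ω| ≤ C

/-- The value at time `t` of a simple process. -/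
def SimpleProcess.eval {ℱ : Filtration ℝ≥0 mΩ} (G : SimpleProcess ℱ) (t : ℝ≥0) (ω : Ω) : ℝ :=
  ∑ j, (Set.Ioc (G.a j) (G.b j)).indicator (fun _ => G.ξ j ω) t

/-- The stochastic integral `∫₀ᵗ G dW` of a simple process. -/
def SimpleProcess.integral {ℱ : Filtration ℝ≥0 mΩ} (G : SimpleProcess ℱ) (W : ℝ≥0 → Ω → ℝ)
    (t : ℝ≥0) (ω : Ω) : ℝ :=
  ∑ j, G.ξ j ω * (W (min (G.b j) t) ω - W (min (G.a j) t) ω)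

/-- The product of Lebesgue measure on `[0, T]` and `P`. -/
def timeProd (P : Measure Ω) (T : ℝ≥0) : Measure (ℝ × Ω) :=
  ((volume : Measure ℝ).restrict (Set.Icc 0 (T : ℝ))).prod P

/-- On `[0, T]`, the process `M` is (a version with continuous paths of) the Itô integral
`M t = ∫₀ᵗ H dW`. The integrand is in the usual domain of the `L²` theory: it is adapted, jointly
measurable up to null sets, and `E ∫₀ᵀ H² du < ∞`. The integral is the `L²` limit of the integrals
of simple processes that converge to `H` in `L²([0, T] × Ω)`. -/
structure IsItoIntegral (P : Measure Ω) (ℱ : Filtration ℝ≥0 mΩ) (W : ℝ≥0 → Ω → ℝ) (T : ℝ≥0)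
    (H M : ℝ≥0 → Ω → ℝ) : Prop where
  adapted : StronglyAdapted ℱ H
  memLp_integrand : MemLp (fun p : ℝ × Ω => H p.1.toNNReal p.2) 2 (timeProd P T)
  memLp : ∀ t ≤ T, MemLp (M t) 2 P
  continuous_paths : ∀ᵐ ω ∂P, ContinuousOn (fun t => M t ω) (Set.Iic T)
  approx : ∃ G : ℕ → SimpleProcess ℱ,
    Tendsto (fun k => eLpNorm (fun p : ℝ × Ω => (G k).eval p.1.toNNReal p.2 - H p.1.toNNReal p.2) 2
      (timeProd P T)) atTop (𝓝 0) ∧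
    ∀ t ≤ T, Tendsto (fun k => eLpNorm (fun ω => (G k).integral W t ω - M t ω) 2 P)
      atTop (𝓝 0)

/-- On `[0, T]`, the path `f` is right continuous with left limits. -/
def IsCadlagOn (T : ℝ≥0) (f : ℝ≥0 → ℝ) : Prop :=
  ∀ t ≤ T, ContinuousWithinAt f (Set.Icc t T) t ∧ ∃ l : ℝ, Tendsto f (𝓝[<] t) (𝓝 l)

/-- The jump `f t - f (t-)`. -/
def jump (f : ℝ≥0 → ℝ) (t : ℝ≥0) : ℝ := f t - Function.leftLim f t

/-- `S` is a price process on `[0, T]` of a stock that pays the dividend `D i` at the ex-dividend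
date `τ i`: it is adapted, right continuous with left limits, and solves
`dS = S r dt + S σ dW + 𝒥 S`, in integrated form, where `𝒥 S` equals `-D i` at time `τ i` and
`0` at all other times. -/
structure IsStockPrice (P : Measure Ω) (ℱ : Filtration ℝ≥0 mΩ) (W : ℝ≥0 → Ω → ℝ) (T : ℝ≥0)
    (r : ℝ → ℝ) (σ : ℝ≥0 → Ω → ℝ) {n : ℕ} (τ : Fin n → ℝ≥0) (D : Fin n → ℝ)
    (S : ℝ≥0 → Ω → ℝ) : Prop where
  adapted : StronglyAdapted ℱ S
  cadlag : ∀ᵐ ω ∂P, IsCadlagOn T (fun t => S t ω)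
  sde : ∃ M : ℝ≥0 → Ω → ℝ, IsItoIntegral P ℱ W T (fun u ω => S u ω * σ u ω) M ∧
    ∀ᵐ ω ∂P, ∀ t ≤ T,
      S t ω = S 0 ω + (∫ u in (0 : ℝ)..(t : ℝ), S u.toNNReal ω * r u) + M t ω
        + ∑ i with τ i ≤ t, jump (fun u => S u ω) (τ i)
  jump_dividend : ∀ᵐ ω ∂P, ∀ i, jump (fun t => S t ω) (τ i) = -D i
  jump_other : ∀ᵐ ω ∂P, ∀ t ≤ T, (∀ i, t ≠ τ i) → jump (fun t => S t ω) t = 0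

/-- The money account `I t = ∑ i, D i * exp (∫ u in (τ i)..t, r u) * 1_[τ i, ∞) (t)` into which
the past dividends are reinvested. -/
def moneyAccount (r : ℝ → ℝ) {n : ℕ} (τ : Fin n → ℝ≥0) (D : Fin n → ℝ) (t : ℝ≥0) : ℝ :=
  ∑ i, (Set.Ici (τ i)).indicator
    (fun t : ℝ≥0 => D i * Real.exp (∫ u in (τ i : ℝ)..(t : ℝ), r u)) t

end DividendStock

end

namespace DividendStock

/-! Put `X = S + I` and `Z = S 0 + M`, where `M` is the Itô integral. Path by path, the price
equation is a linear Volterra equation `x = z + ∫ x r` whose forcing `z` is `Z` minus the dividends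
paid so far. Variation of constants (`eq_add_integral_of_eq_add_integral`) solves it by ordinary
integration by parts, so no Itô formula is needed; the dividends contribute exactly `-I`
(`add_moneyAccount_eq`). Hence `X t = Z t + ∫₀ᵗ Z u r u exp (∫ᵤᵗ r) du`. Since `M` is a martingale
(`IsItoIntegral.ae_eq_condExp`), `Z` has constant mean over each `A` in `ℱ t` after time `t`. Fubini
then shows that the mean of `X` over `A` grows by the factor `exp (∫ₜᵀ r)` from `t` to `T`
(`integrable_and_setIntegral_eq_exp_mul`). As `I` is deterministic, this is the claim. -/

theorem absolutelyContinuousOnInterval_exp {f : ℝ → ℝ} {a b : ℝ}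
    (hf : AbsolutelyContinuousOnInterval f a b) :
    AbsolutelyContinuousOnInterval (fun x => Real.exp (f x)) a b := by
  obtain ⟨C, hC⟩ := hf.exists_bound
  -- `exp` is Lipschitz on the bounded range of `f`, and a Lipschitz map preserves absolute
  -- continuity.
  have hlip : ∀ x ∈ Set.Icc (-C) C, ∀ y ∈ Set.Icc (-C) C,
      dist (Real.exp x) (Real.exp y) ≤ Real.exp C * dist x y := by
    intro x hx y hy
    rw [dist_eq_norm, dist_eq_norm]
    refine (convex_Icc (-C) C).norm_image_sub_le_of_norm_deriv_le
      (fun z _ => Real.differentiableAt_exp) (fun z hz => ?_) hy hx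
    rw [Real.deriv_exp, Real.norm_eq_abs, Real.abs_exp]
    exact Real.exp_le_exp.2 hz.2
  have hmem : ∀ x ∈ Set.uIcc a b, f x ∈ Set.Icc (-C) C := fun x hx => abs_le.1 (hC x hx)
  unfold AbsolutelyContinuousOnInterval at hf ⊢
  refine squeeze_zero' (Eventually.of_forall fun _ => Finset.sum_nonneg fun i _ => dist_nonneg) ?_
    (by simpa using Tendsto.const_mul (Real.exp C) hf)
  rw [eventually_inf_principal]
  filter_upwards with E hE
  rw [Finset.mul_sum]
  refine Finset.sum_le_sum fun i hi => ?_
  exact hlip _ (hmem _ (hE.1 i hi).1) _ (hmem _ (hE.1 i hi).2)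

/-! ### The exponential kernel and variation of constants. -/

section Kernel

variable {r : ℝ → ℝ} {a b : ℝ}

theorem absolutelyContinuousOnInterval_exp_integral (hr : IntervalIntegrable r volume a b) :
    AbsolutelyContinuousOnInterval (fun x => Real.exp (∫ v in x..b, r v)) a b := by
  apply absolutelyContinuousOnInterval_exp
  have h := (hr.absolutelyContinuousOnInterval_intervalIntegral (c := b) (by simp)).neg
  have heq : (fun x => ∫ v in x..b, r v) = -fun x => ∫ v in b..x, r v :=
    funext fun x => intervalIntegral.integral_symm b x
  rwa [heq]

theorem ae_hasDerivAt_exp_integral (hr : IntervalIntegrable r volume a b) :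
    ∀ᵐ x, x ∈ Set.uIcc a b → HasDerivAt (fun x => Real.exp (∫ v in x..b, r v))
      (-(r x * Real.exp (∫ v in x..b, r v))) x := by
  filter_upwards [hr.ae_hasDerivAt_integral] with x hx hxm
  have h := (hx hxm b (by simp)).neg.exp
  simp only [Pi.neg_apply, ← intervalIntegral.integral_symm] at h
  convert h using 1
  ring

/-- The integrand is minus the derivative of the kernel, but only almost everywhere since `r` is
merely integrable. Absolute continuity still gives the fundamental theorem of calculus. -/
theorem integral_mul_exp_integral (hr : IntervalIntegrable r volume a b) :
    ∫ u in a..b, r u * Real.exp (∫ v in u..b, r v) = Real.exp (∫ v in a..b, r v) - 1 := by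
  have h := (absolutelyContinuousOnInterval_exp_integral hr).integral_deriv_eq_sub
  have hc : ∫ u in a..b, deriv (fun x => Real.exp (∫ v in x..b, r v)) u
      = ∫ u in a..b, -(r u * Real.exp (∫ v in u..b, r v)) := by
    apply intervalIntegral.integral_congr_ae
    filter_upwards [ae_hasDerivAt_exp_integral hr] with x hx hxm
    exact (hx (Set.uIoc_subset_uIcc hxm)).deriv
  rw [hc, intervalIntegral.integral_neg] at h
  simp only [intervalIntegral.integral_same, Real.exp_zero] at h
  linarith

theorem intervalIntegrable_mul_exp_integral (hr : IntervalIntegrable r volume a b) :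
    IntervalIntegrable (fun u => r u * Real.exp (∫ v in u..b, r v)) volume a b :=
  hr.mul_continuousOn (absolutelyContinuousOnInterval_exp_integral hr).continuousOn

/-- Variation of constants for the linear Volterra equation `x = z + ∫ x r`. -/
theorem eq_add_integral_of_eq_add_integral {x z : ℝ → ℝ} (hr : IntervalIntegrable r volume a b)
    (hx : IntervalIntegrable (fun u => x u * r u) volume a b)
    (h : ∀ u ∈ Set.uIcc a b, x u = z u + ∫ v in a..u, x v * r v) :
    x b = z b + ∫ u in a..b, z u * (r u * Real.exp (∫ v in u..b, r v)) := by
  have hY := hx.absolutelyContinuousOnInterval_intervalIntegral (c := a) (by simp)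
  -- With `Y = ∫ x r` and kernel `K`, `(Y K)' = (x - Y) r K = z r K` almost everywhere, while `Y a =
  -- 0` and `K b = 1`.
  have key := hY.integral_deriv_mul_eq_sub (absolutelyContinuousOnInterval_exp_integral hr)
  have hc : ∫ u in a..b, (deriv (fun u => ∫ v in a..u, x v * r v) u
        * Real.exp (∫ v in u..b, r v) + (∫ v in a..u, x v * r v)
        * deriv (fun x => Real.exp (∫ v in x..b, r v)) u)
      = ∫ u in a..b, z u * (r u * Real.exp (∫ v in u..b, r v)) := by
    apply intervalIntegral.integral_congr_ae
    filter_upwards [ae_hasDerivAt_exp_integral hr, hx.ae_hasDerivAt_integral] with u hu hu' hm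
    have hm := Set.uIoc_subset_uIcc hm
    rw [(hu hm).deriv, (hu' hm a (by simp)).deriv, h u hm]
    ring
  rw [hc] at key
  simp only [intervalIntegral.integral_same, Real.exp_zero] at key
  rw [h b (by simp), key]
  ring

end Kernel

/-! ### Regularity of càdlàg paths. -/

section Path

variable {T : ℝ≥0} {f : ℝ≥0 → ℝ}

theorem IsCadlagOn.continuousWithinAt_of_jump_eq_zero (hf : IsCadlagOn T f) {t : ℝ≥0} (ht : t ≤ T)
    (hj : jump f t = 0) : ContinuousWithinAt f (Set.Iic T) t := by
  obtain ⟨hr, l, hl⟩ := hf t ht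
  have hleft : ContinuousWithinAt f (Set.Iio t) t := by
    -- The trivial filter occurs at `t = 0`, where left continuity is vacuous.
    rcases eq_or_neBot (𝓝[<] t) with h | h
    · simp [ContinuousWithinAt, h]
    · have hlt : Function.leftLim f t = l := leftLim_eq_of_tendsto hl
      rw [jump, hlt, sub_eq_zero] at hj
      rwa [ContinuousWithinAt, hj]
  refine (hleft.union hr).mono fun x hx => ?_
  rcases lt_or_ge x t with h | h
  · exact Or.inl h
  · exact Or.inr ⟨h, hx⟩

theorem IsCadlagOn.exists_bound (hf : IsCadlagOn T f) : ∃ C, ∀ t ≤ T, |f t| ≤ C := by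
  suffices h : Bornology.IsBounded (f '' Set.Iic T) by
    obtain ⟨C, hC⟩ := h.exists_norm_le
    exact ⟨C, fun t ht => hC _ ⟨t, ht, rfl⟩⟩
  have hK : IsCompact (Set.Iic T) := by
    rw [← Set.Icc_bot]; exact isCompact_Icc
  refine hK.induction_on (p := fun s => Bornology.IsBounded (f '' s)) (by simp)
    (fun s t hst ht => ht.subset (Set.image_mono hst))
    (fun s t hs ht => by rw [Set.image_union]; exact hs.union ht) fun t ht => ?_
  obtain ⟨hr, l, hl⟩ := hf t ht
  have aux : ∀ {F : Filter ℝ≥0} {y : ℝ}, Tendsto f F (𝓝 y) →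
      ∃ s ∈ F, Bornology.IsBounded (f '' s) := fun {F y} h =>
    ⟨f ⁻¹' Metric.ball y 1, h (Metric.ball_mem_nhds y one_pos),
      Metric.isBounded_ball.subset (Set.image_preimage_subset _ _)⟩
  obtain ⟨s₁, h₁, b₁⟩ := aux hl
  obtain ⟨s₂, h₂, b₂⟩ := aux hr
  refine ⟨s₁ ∪ s₂, ?_, by rw [Set.image_union]; exact b₁.union b₂⟩
  have : 𝓝[Set.Iic T] t ≤ 𝓝[<] t ⊔ 𝓝[Set.Icc t T] t := by
    rw [← nhdsWithin_union]
    refine nhdsWithin_mono _ fun x hx => ?_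
    rcases lt_or_ge x t with h | h
    · exact Or.inl h
    · exact Or.inr ⟨h, hx⟩
  exact this (union_mem_sup h₁ h₂)

/-- The path is bounded, and continuous off a finite set, which is Lebesgue null. -/
theorem IsCadlagOn.intervalIntegrable_mul (hf : IsCadlagOn T f) {s : Set ℝ≥0} (hs : s.Finite)
    (hj : ∀ t ≤ T, t ∉ s → jump f t = 0) {r : ℝ → ℝ} (hr : IntervalIntegrable r volume 0 T) :
    IntervalIntegrable (fun u => f u.toNNReal * r u) volume 0 T := by
  obtain ⟨C, hC⟩ := hf.exists_bound
  rw [intervalIntegrable_iff_integrableOn_Ioc_of_le (NNReal.coe_nonneg T)] at hr ⊢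
  have hmeas : AEStronglyMeasurable (fun u : ℝ => f u.toNNReal)
      (volume.restrict (Set.Ioc (0 : ℝ) T)) := by
    have hfin : ((↑) '' s : Set ℝ).Finite := hs.image _
    have hcont : ContinuousOn (fun u : ℝ => f u.toNNReal) (Set.Ioc (0 : ℝ) T \ (↑) '' s) := by
      rintro u ⟨hu, hus⟩
      have hut : u.toNNReal ≤ T := by
        rw [Real.toNNReal_le_iff_le_coe]; exact hu.2
      have := hf.continuousWithinAt_of_jump_eq_zero hut
        (hj _ hut fun h => hus ⟨_, h, Real.coe_toNNReal _ hu.1.le⟩)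
      exact this.comp continuous_real_toNNReal.continuousWithinAt fun v hv => by
        rw [Set.mem_Iic, Real.toNNReal_le_iff_le_coe]; exact hv.1.2
    have := hcont.aestronglyMeasurable (μ := volume)
      (measurableSet_Ioc.diff hfin.measurableSet)
    rwa [Measure.restrict_congr_set (sdiff_null_ae_eq_self (hfin.measure_zero _))] at this
  refine hr.bdd_mul (c := C) hmeas ?_
  rw [ae_restrict_iff' measurableSet_Ioc]
  refine Eventually.of_forall fun u hu => hC _ ?_
  rw [Real.toNNReal_le_iff_le_coe]; exact hu.2

end Path

/-! ### Integrals of a single dividend step against a kernel. -/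

section Dividend

variable {k : ℝ → ℝ} {t : ℝ≥0}

theorem integral_ite_mul_of_lt (D : ℝ) {s : ℝ≥0} (h : t < s) :
    ∫ u in (0 : ℝ)..t, (if s ≤ u.toNNReal then D else 0) * k u = 0 := by
  rw [intervalIntegral.integral_congr (g := fun _ => (0 : ℝ))]
  · simp
  · intro u hu
    rw [Set.uIcc_of_le (NNReal.coe_nonneg t)] at hu
    have : u.toNNReal < s := lt_of_le_of_lt (Real.toNNReal_le_iff_le_coe.2 hu.2) h
    simp [this]

theorem intervalIntegrable_ite_mul (hk : IntervalIntegrable k volume 0 t) (D : ℝ) (s : ℝ≥0) :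
    IntervalIntegrable (fun u : ℝ => (if s ≤ u.toNNReal then D else 0) * k u) volume 0 t := by
  rw [intervalIntegrable_iff] at hk ⊢
  refine hk.bdd_mul (c := |D|) ?_ (Eventually.of_forall fun u => ?_)
  · refine (Measurable.ite ?_ measurable_const measurable_const).aestronglyMeasurable
    exact measurableSet_le measurable_const measurable_real_toNNReal
  · split_ifs <;> simp

theorem integral_ite_mul_of_le (hk : IntervalIntegrable k volume 0 t) (D : ℝ) {s : ℝ≥0}
    (h : s ≤ t) :
    ∫ u in (0 : ℝ)..t, (if s ≤ u.toNNReal then D else 0) * k u = D * ∫ u in (s : ℝ)..t, k u := by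
  have hi := intervalIntegrable_ite_mul hk D s
  have hst : (s : ℝ) ≤ t := h
  have hmem : (s : ℝ) ∈ Set.uIcc (0 : ℝ) t := by
    rw [Set.uIcc_of_le (NNReal.coe_nonneg t)]; exact ⟨s.2, hst⟩
  rw [← intervalIntegral.integral_add_adjacent_intervals (b := (s : ℝ))
    (hi.mono_set (Set.uIcc_subset_uIcc_left hmem))
    (hi.mono_set (Set.uIcc_subset_uIcc_right hmem))]
  have h₁ : ∫ u in (0 : ℝ)..s, (if s ≤ u.toNNReal then D else 0) * k u = 0 := by
    rw [intervalIntegral.integral_congr_ae (g := fun _ => (0 : ℝ))]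
    · simp
    -- The step is already on at the endpoint `u = s`, so the integrand vanishes only almost
    -- everywhere.
    · filter_upwards [Measure.ae_ne volume (s : ℝ)] with u hne hu
      rw [Set.uIoc_of_le (NNReal.coe_nonneg s)] at hu
      have : u.toNNReal < s := (Real.toNNReal_lt_iff_lt_coe hu.1.le).2 (lt_of_le_of_ne hu.2 hne)
      simp [this]
  have h₂ : ∫ u in (s : ℝ)..t, (if s ≤ u.toNNReal then D else 0) * k u
      = ∫ u in (s : ℝ)..t, D * k u := by
    refine intervalIntegral.integral_congr fun u hu => ?_
    rw [Set.uIcc_of_le hst] at hu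
    have : s ≤ u.toNNReal := NNReal.le_toNNReal_of_coe_le hu.1
    simp [this]
  rw [h₁, h₂, zero_add, intervalIntegral.integral_const_mul]

end Dividend

/-! ### The money account and the pathwise solution. -/

variable {T : ℝ≥0} {r : ℝ → ℝ}

theorem _root_.IntervalIntegrable.mono_nnreal {f : ℝ → ℝ} (hf : IntervalIntegrable f volume 0 T)
    {s t : ℝ≥0} (hs : s ≤ T) (ht : t ≤ T) : IntervalIntegrable f volume s t := by
  refine hf.mono_set ?_
  rw [Set.uIcc_of_le (NNReal.coe_nonneg T)]
  exact Set.uIcc_subset_Icc ⟨s.2, hs⟩ ⟨t.2, ht⟩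

/-- The dividends paid, compounded by the kernel of the variation of constants formula, are the
money account. -/
theorem sum_ite_add_integral_eq_moneyAccount (hr : IntervalIntegrable r volume 0 T) {n : ℕ}
    (τ : Fin n → ℝ≥0) (D : Fin n → ℝ) {t : ℝ≥0} (ht : t ≤ T) :
    ∑ i, ((if τ i ≤ t then D i else 0) + ∫ u in (0 : ℝ)..t,
      (if τ i ≤ u.toNNReal then D i else 0) * (r u * Real.exp (∫ v in u..t, r v)))
      = moneyAccount r τ D t := by
  have hrt : IntervalIntegrable r volume 0 t := by simpa using hr.mono_nnreal (zero_le (a := T)) ht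
  refine Finset.sum_congr rfl fun i _ => ?_
  by_cases h : τ i ≤ t
  · have hri : IntervalIntegrable r volume (τ i) t := hr.mono_nnreal (h.trans ht) ht
    rw [integral_ite_mul_of_le (intervalIntegrable_mul_exp_integral hrt) _ h,
      integral_mul_exp_integral hri, Set.indicator_of_mem (Set.mem_Ici.2 h), if_pos h]
    ring
  · rw [integral_ite_mul_of_lt _ (not_le.1 h), Set.indicator_of_notMem (by simpa using h),
      if_neg h, zero_add]

/-- Pathwise solution of the price equation: the price plus the money account is the solution of
the Volterra equation without dividends. -/
theorem add_moneyAccount_eq {s m : ℝ≥0 → ℝ} (hr : IntervalIntegrable r volume 0 T) {n : ℕ}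
    {τ : Fin n → ℝ≥0} {D : Fin n → ℝ} (hs : IsCadlagOn T s) (hm : ContinuousOn m (Set.Iic T))
    (heq : ∀ t ≤ T, s t = s 0 + (∫ u in (0 : ℝ)..(t : ℝ), s u.toNNReal * r u) + m t
      + ∑ i with τ i ≤ t, jump s (τ i))
    (hjump : ∀ i, jump s (τ i) = -D i) (hother : ∀ t ≤ T, (∀ i, t ≠ τ i) → jump s t = 0)
    {t : ℝ≥0} (ht : t ≤ T) :
    s t + moneyAccount r τ D t = (s 0 + m t) + ∫ u in (0 : ℝ)..t,
      (s 0 + m u.toNNReal) * (r u * Real.exp (∫ v in u..t, r v)) := by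
  have hrt : IntervalIntegrable r volume 0 t := by simpa using hr.mono_nnreal (zero_le (a := T)) ht
  have hk := intervalIntegrable_mul_exp_integral hrt
  have hsr : IntervalIntegrable (fun u => s u.toNNReal * r u) volume 0 t := by
    simpa using (hs.intervalIntegrable_mul (Set.finite_range τ)
      (fun t ht h => hother t ht fun i hi => h ⟨i, hi.symm⟩) hr).mono_nnreal (zero_le (a := T)) ht
  have hmt : ContinuousOn (fun u : ℝ => s 0 + m u.toNNReal) (Set.uIcc (0 : ℝ) t) := by
    refine continuousOn_const.add (hm.comp continuous_real_toNNReal.continuousOn fun u hu => ?_)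
    rw [Set.uIcc_of_le (NNReal.coe_nonneg t)] at hu
    exact (Real.toNNReal_le_iff_le_coe.2 hu.2).trans ht
  -- The jumps are moved into the forcing term; the solution formula is linear in it, so the
  -- dividends split off.
  have key := eq_add_integral_of_eq_add_integral (x := fun u => s u.toNNReal)
    (z := fun u => s 0 + m u.toNNReal - ∑ i, if τ i ≤ u.toNNReal then D i else 0) hrt hsr ?_
  · rw [← sum_ite_add_integral_eq_moneyAccount hr τ D ht, Finset.sum_add_distrib,
      ← intervalIntegral.integral_finsetSum fun i _ => intervalIntegrable_ite_mul hk _ _]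
    have hsum := IntervalIntegrable.sum Finset.univ fun i _ =>
      intervalIntegrable_ite_mul hk (D i) (τ i)
    rw [Finset.sum_fn] at hsum
    simp only [sub_mul, Finset.sum_mul] at key
    rw [intervalIntegral.integral_sub (hk.continuousOn_mul hmt) hsum] at key
    simp only [Real.toNNReal_coe] at key
    rw [key]
    ring
  · intro u hu
    rw [Set.uIcc_of_le (NNReal.coe_nonneg t)] at hu
    have huT : u.toNNReal ≤ T := (Real.toNNReal_le_iff_le_coe.2 hu.2).trans ht
    have h := heq _ huT
    simp only [hjump, Finset.sum_neg_distrib, Finset.sum_filter, Real.coe_toNNReal _ hu.1] at h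
    rw [h]
    ring

/-! ### The martingale property of the Itô integral. -/

section Ito

variable {Ω : Type*} {mΩ : MeasurableSpace Ω} {P : Measure Ω} {ℱ : Filtration ℝ≥0 mΩ}
  {W : ℝ≥0 → Ω → ℝ}

theorem IsBrownianWrt.integrable_sub (hW : IsBrownianWrt P ℱ W) (s t : ℝ≥0) :
    Integrable (fun ω => W t ω - W s ω) P :=
  (hW.isBrownian.integrable_eval t).sub (hW.isBrownian.integrable_eval s)

theorem IsBrownianWrt.integrable_mul_sub (hW : IsBrownianWrt P ℱ W) {ξ : Ω → ℝ} {a : ℝ≥0}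
    (hξ : StronglyMeasurable[ℱ a] ξ) (hb : ∃ C : ℝ, ∀ ω, |ξ ω| ≤ C) (s t : ℝ≥0) :
    Integrable (fun ω => ξ ω * (W t ω - W s ω)) P := by
  obtain ⟨C, hC⟩ := hb
  exact (hW.integrable_sub s t).bdd_mul (c := C) (hξ.mono (ℱ.le a)).aestronglyMeasurable
    (Eventually.of_forall hC)

theorem SimpleProcess.integrable_integral (hW : IsBrownianWrt P ℱ W) (G : SimpleProcess ℱ)
    (t : ℝ≥0) : Integrable (G.integral W t) P :=
  integrable_finsetSum _ fun j _ =>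
    hW.integrable_mul_sub (G.measurable_ξ j) (G.bounded_ξ j) _ _

theorem SimpleProcess.stronglyMeasurable_integral (hW : IsBrownianWrt P ℱ W)
    (G : SimpleProcess ℱ) (t : ℝ≥0) : StronglyMeasurable[ℱ t] (G.integral W t) := by
  refine Finset.stronglyMeasurable_fun_sum _ fun j _ => ?_
  have hWm : ∀ s, StronglyMeasurable[ℱ t] (W (min s t)) := fun s =>
    (hW.adapted _).mono (ℱ.mono (min_le_right _ _))
  rcases le_total (G.a j) t with h | h
  · exact ((G.measurable_ξ j).mono (ℱ.mono h)).mul ((hWm _).sub (hWm _))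
  -- Here `ξ j` need not be `ℱ t`-measurable, but its increment stopped at `t` is zero.
  · simp only [min_eq_right h, min_eq_right (h.trans (G.a_le_b j)), sub_self, mul_zero]
    exact stronglyMeasurable_const

variable [IsProbabilityMeasure P]

/-- Given `ℱ s`, the factor `ξ` pulls out and the independent centred increment averages to zero;
the tower property passes to `ℱ u`. -/
theorem IsBrownianWrt.condExp_mul_sub_eq_zero (hW : IsBrownianWrt P ℱ W) {ξ : Ω → ℝ}
    {a s t u : ℝ≥0} (hξ : StronglyMeasurable[ℱ a] ξ) (hb : ∃ C : ℝ, ∀ ω, |ξ ω| ≤ C)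
    (has : a ≤ s) (hst : s ≤ t) (hus : u ≤ s) :
    P[fun ω => ξ ω * (W t ω - W s ω) | ℱ u] =ᵐ[P] 0 := by
  have hmeas : ∀ t, Measurable (W t) := fun t => ((hW.adapted t).mono (ℱ.le t)).measurable
  have h₁ : P[fun ω => W t ω - W s ω | ℱ s] =ᵐ[P] 0 := by
    refine (condExp_indep_eq ((hmeas t).sub (hmeas s)).comap_le (ℱ.le s)
      (comap_measurable _).stronglyMeasurable (hW.indep s t hst)).trans ?_
    rw [integral_sub' (hW.isBrownian.integrable_eval t) (hW.isBrownian.integrable_eval s),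
      hW.isBrownian.integral_eval, hW.isBrownian.integral_eval, sub_zero]
    rfl
  have h₂ : P[fun ω => ξ ω * (W t ω - W s ω) | ℱ s] =ᵐ[P] 0 := by
    refine (condExp_mul_of_stronglyMeasurable_left (hξ.mono (ℱ.mono has))
      (hW.integrable_mul_sub hξ hb s t) (hW.integrable_sub s t)).trans ?_
    filter_upwards [h₁] with ω hω
    simp [hω]
  refine (condExp_condExp_of_le (ℱ.mono hus) (ℱ.le s)).symm.trans
    ((condExp_congr_ae h₂).trans ?_)
  rw [condExp_zero]

theorem SimpleProcess.condExp_integral (hW : IsBrownianWrt P ℱ W) (G : SimpleProcess ℱ)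
    {s t : ℝ≥0} (hst : s ≤ t) : P[G.integral W t | ℱ s] =ᵐ[P] G.integral W s := by
  -- Clamping the endpoints to `[s, t]` isolates the part of each increment after `s`.
  let c : ℝ≥0 → ℝ≥0 := fun x => max s (min x t)
  have hc : ∀ x ω, W (min x t) ω - W (min x s) ω = W (c x) ω - W s ω := by
    intro x ω
    rcases le_total x s with h | h
    · simp [c, min_eq_left h, min_eq_left (h.trans hst), max_eq_left h]
    · simp [c, min_eq_right h, max_eq_right (le_min h hst)]
  have hsplit : G.integral W t = G.integral W s
      + ∑ j, fun ω => G.ξ j ω * (W (c (G.b j)) ω - W (c (G.a j)) ω) := by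
    ext ω
    simp only [SimpleProcess.integral, Pi.add_apply, Finset.sum_apply, ← Finset.sum_add_distrib]
    refine Finset.sum_congr rfl fun j _ => ?_
    linear_combination G.ξ j ω * (hc (G.b j) ω - hc (G.a j) ω)
  have hint : ∀ j, Integrable (fun ω => G.ξ j ω * (W (c (G.b j)) ω - W (c (G.a j)) ω)) P :=
    fun j => hW.integrable_mul_sub (G.measurable_ξ j) (G.bounded_ξ j) _ _
  have hzero : ∀ j, P[fun ω => G.ξ j ω * (W (c (G.b j)) ω - W (c (G.a j)) ω) | ℱ s] =ᵐ[P] 0 := by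
    intro j
    rcases le_total (G.a j) t with h | h
    · refine hW.condExp_mul_sub_eq_zero (G.measurable_ξ j) (G.bounded_ξ j) ?_ ?_ (le_max_left _ _)
      · exact (le_min le_rfl h).trans (le_max_right _ _)
      · exact max_le_max le_rfl (min_le_min (G.a_le_b j) le_rfl)
    · simp only [c, min_eq_right h, min_eq_right (h.trans (G.a_le_b j)), sub_self, mul_zero]
      exact (condExp_zero (m := ℱ s) (μ := P)).eventuallyEq
  rw [hsplit]
  refine (condExp_add (G.integrable_integral hW s) (integrable_finsetSum' _ fun j _ => hint j)
    (ℱ s)).trans ?_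
  rw [condExp_of_stronglyMeasurable (ℱ.le s) (G.stronglyMeasurable_integral hW s)
    (G.integrable_integral hW s)]
  filter_upwards [condExp_finsetSum (fun j (_ : j ∈ Finset.univ) => hint j) (ℱ s),
    ae_all_iff.2 hzero] with ω h₁ h₂
  simp [h₁, h₂]

variable {T : ℝ≥0} {H M : ℝ≥0 → Ω → ℝ}

theorem IsItoIntegral.integrable (hM : IsItoIntegral P ℱ W T H M) {t : ℝ≥0} (ht : t ≤ T) :
    Integrable (M t) P :=
  (hM.memLp t ht).integrable one_le_two

/-- The Itô integral is a martingale. -/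
theorem IsItoIntegral.ae_eq_condExp (hW : IsBrownianWrt P ℱ W) (hM : IsItoIntegral P ℱ W T H M)
    {t : ℝ≥0} (ht : t ≤ T) : M t =ᵐ[P] P[M T | ℱ t] := by
  obtain ⟨G, -, hG⟩ := hM.approx
  have hL1 : ∀ s ≤ T, Tendsto (fun k => eLpNorm ((G k).integral W s - M s) 1 P) atTop (𝓝 0) :=
    fun s hs => tendsto_of_tendsto_of_tendsto_of_le_of_le tendsto_const_nhds (hG s hs)
      (fun _ => zero_le) fun k => eLpNorm_le_eLpNorm_of_exponent_le one_le_two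
        (((G k).integrable_integral hW s).sub (hM.integrable hs)).aestronglyMeasurable
  have hMt := hM.integrable ht
  have hMT := hM.integrable le_rfl
  -- The simple integrals are martingales and conditional expectation contracts `L¹`, so the defect
  -- is controlled by the approximation errors at `t` and `T`.
  have hbound : ∀ k, eLpNorm (M t - P[M T | ℱ t]) 1 P
      ≤ eLpNorm ((G k).integral W t - M t) 1 P + eLpNorm ((G k).integral W T - M T) 1 P := by
    intro k
    have hGt := (G k).integrable_integral hW t
    have hGT := (G k).integrable_integral hW T
    have hae : M t - P[M T | ℱ t] =ᵐ[P]
        P[(G k).integral W T - M T | ℱ t] - ((G k).integral W t - M t) := by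
      filter_upwards [condExp_sub hGT hMT (ℱ t), (G k).condExp_integral hW ht] with ω h₁ h₂
      simp only [Pi.sub_apply] at h₁ ⊢
      rw [h₁, h₂]
      ring
    rw [eLpNorm_congr_ae hae, add_comm]
    refine (eLpNorm_sub_le integrable_condExp.aestronglyMeasurable
      (hGt.sub hMt).aestronglyMeasurable le_rfl).trans ?_
    gcongr
    exact eLpNorm_condExp_le_eLpNorm _ le_rfl
  have hzero : eLpNorm (M t - P[M T | ℱ t]) 1 P = 0 := by
    have := ge_of_tendsto' ((hL1 t ht).add (hL1 T le_rfl)) hbound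
    simpa using this
  rw [eLpNorm_eq_zero_iff (hMt.sub integrable_condExp).aestronglyMeasurable one_ne_zero] at hzero
  filter_upwards [hzero] with ω hω
  exact sub_eq_zero.1 hω

theorem IsItoIntegral.setIntegral_eq (hW : IsBrownianWrt P ℱ W) (hM : IsItoIntegral P ℱ W T H M)
    {t u : ℝ≥0} (htu : t ≤ u) (hu : u ≤ T) {A : Set Ω} (hA : MeasurableSet[ℱ t] A) :
    ∫ ω in A, M u ω ∂P = ∫ ω in A, M t ω ∂P := by
  have hset : ∀ s, t ≤ s → s ≤ T → ∫ ω in A, M s ω ∂P = ∫ ω in A, M T ω ∂P := fun s hts hs => by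
    rw [integral_congr_ae (ae_restrict_of_ae (hM.ae_eq_condExp hW hs))]
    exact setIntegral_condExp (ℱ.le s) (hM.integrable le_rfl) (ℱ.mono hts _ hA)
  rw [hset u htu hu, hset t le_rfl (htu.trans hu)]

end Ito

/-! ### Joint measurability and exchange of integrals. -/

section Fubini

variable {Ω : Type*} {mΩ : MeasurableSpace Ω} {P : Measure Ω} {T : ℝ≥0}
  {Z : ℝ≥0 → Ω → ℝ}

/-- A process with almost surely continuous paths is jointly measurable up to null sets. -/
theorem aestronglyMeasurable_timeProd (hm : ∀ t ≤ T, AEStronglyMeasurable (Z t) P)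
    (hc : ∀ᵐ ω ∂P, ContinuousOn (fun t => Z t ω) (Set.Iic T)) :
    AEStronglyMeasurable (fun q : ℝ × Ω => Z q.1.toNNReal q.2) (timeProd P T) := by
  -- Time is rounded down to the grid of mesh `1 / k`, so each approximant sees time only through an
  -- integer. The cap at `T` stays where `Z` is controlled.
  let d : ℕ → ℕ → ℝ≥0 := fun k j => min ((j : ℝ≥0) / k) T
  have hd : ∀ k j, AEStronglyMeasurable (Z (d k j)) P := fun k j => hm _ (min_le_right _ _)
  have happrox : ∀ k, AEStronglyMeasurable
      (fun q : ℝ × Ω => Z (d k ⌊q.1 * k⌋₊) q.2) (timeProd P T) := by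
    intro k
    have hmk : Measurable fun q : ℕ × Ω => (hd k q.1).mk _ q.2 :=
      measurable_from_prod_countable_right fun j => (hd k j).stronglyMeasurable_mk.measurable
    have hfl : Measurable fun q : ℝ × Ω => (⌊q.1 * k⌋₊, q.2) :=
      (Nat.measurable_floor.comp (measurable_fst.mul_const _)).prodMk measurable_snd
    refine ⟨_, (hmk.comp hfl).stronglyMeasurable, ?_⟩
    have h : ∀ᵐ ω ∂P, ∀ j, Z (d k j) ω = (hd k j).mk _ ω :=
      ae_all_iff.2 fun j => (hd k j).ae_eq_mk
    filter_upwards [Measure.quasiMeasurePreserving_snd.ae h] with q hq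
    exact hq _
  refine aestronglyMeasurable_of_tendsto_ae atTop happrox ?_
  have hnn : ∀ᵐ u : ℝ ∂(volume.restrict (Set.Icc 0 (T : ℝ))), u ∈ Set.Icc 0 (T : ℝ) :=
    ae_restrict_mem measurableSet_Icc
  filter_upwards [Measure.quasiMeasurePreserving_snd.ae hc,
    Measure.quasiMeasurePreserving_fst.ae hnn] with q hq hu
  have huT : q.1.toNNReal ≤ T := Real.toNNReal_le_iff_le_coe.2 hu.2
  have hlim : Tendsto (fun k : ℕ => d k ⌊q.1 * k⌋₊) atTop (𝓝 q.1.toNNReal) := by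
    have h₀ : Tendsto (fun k : ℕ => ((⌊q.1 * k⌋₊ : ℝ≥0) / k)) atTop (𝓝 q.1.toNNReal) := by
      rw [← NNReal.tendsto_coe, Real.coe_toNNReal _ hu.1]
      simpa [Function.comp_def] using (tendsto_nat_floor_mul_div_atTop hu.1).comp tendsto_natCast_atTop_atTop
    simpa [d, min_eq_left huT] using h₀.min (tendsto_const_nhds (x := T))
  exact (hq _ huT).tendsto.comp
    (tendsto_nhdsWithin_iff.2
      ⟨hlim, Eventually.of_forall fun k => Set.mem_Iic.2 (min_le_right _ _)⟩)

variable [SFinite P]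

theorem integrable_mul_timeProd (hm : ∀ t ≤ T, Integrable (Z t) P)
    (hc : ∀ᵐ ω ∂P, ContinuousOn (fun t => Z t ω) (Set.Iic T)) {C : ℝ}
    (hC : ∀ t ≤ T, ∫ ω, |Z t ω| ∂P ≤ C) {k : ℝ → ℝ} (hk : IntervalIntegrable k volume 0 T) :
    Integrable (fun q : ℝ × Ω => Z q.1.toNNReal q.2 * k q.1) (timeProd P T) := by
  rw [intervalIntegrable_iff_integrableOn_Icc_of_le (NNReal.coe_nonneg T)] at hk
  have hmeas : AEStronglyMeasurable (fun q : ℝ × Ω => Z q.1.toNNReal q.2 * k q.1)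
      (timeProd P T) :=
    (aestronglyMeasurable_timeProd (fun t ht => (hm t ht).aestronglyMeasurable) hc).mul
      hk.aestronglyMeasurable.comp_fst
  have hle : ∀ᵐ u : ℝ ∂(volume.restrict (Set.Icc 0 (T : ℝ))), u.toNNReal ≤ T := by
    rw [ae_restrict_iff' measurableSet_Icc]
    exact Eventually.of_forall fun u hu => Real.toNNReal_le_iff_le_coe.2 hu.2
  refine (integrable_prod_iff hmeas).2 ⟨?_, ?_⟩
  · filter_upwards [hle] with u hu
    exact (hm _ hu).mul_const _
  · refine (hk.norm.const_mul C).mono' hmeas.norm.integral_prod_right' ?_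
    filter_upwards [hle] with u hu
    simp only [norm_mul, integral_mul_const, Real.norm_eq_abs, abs_abs]
    rw [abs_of_nonneg (integral_nonneg fun ω => abs_nonneg _)]
    exact mul_le_mul_of_nonneg_right (hC _ hu) (abs_nonneg _)

theorem integrable_intervalIntegral_of_timeProd {F : ℝ × Ω → ℝ}
    (hF : Integrable F (timeProd P T)) :
    Integrable (fun ω => ∫ u in (0 : ℝ)..T, F (u, ω)) P := by
  have h : Integrable (fun ω => ∫ u in Set.Icc 0 (T : ℝ), F (u, ω)) P := hF.integral_prod_right
  simpa only [intervalIntegral.integral_of_le (NNReal.coe_nonneg T), integral_Icc_eq_integral_Ioc]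
    using h

theorem intervalIntegrable_setIntegral_of_timeProd {F : ℝ × Ω → ℝ}
    (hF : Integrable F (timeProd P T)) (A : Set Ω) :
    IntervalIntegrable (fun u => ∫ ω in A, F (u, ω) ∂P) volume 0 T := by
  rw [intervalIntegrable_iff_integrableOn_Icc_of_le (NNReal.coe_nonneg T)]
  -- The restriction to `A` is dominated by `P` even for nonmeasurable `A`.
  exact (hF.mono_measure (Measure.prod_mono le_rfl Measure.restrict_le_self)).integral_prod_left

theorem setIntegral_intervalIntegral_swap {F : ℝ × Ω → ℝ}
    (hF : Integrable F (timeProd P T)) (A : Set Ω) :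
    ∫ ω in A, (∫ u in (0 : ℝ)..T, F (u, ω)) ∂P = ∫ u in (0 : ℝ)..T, ∫ ω in A, F (u, ω) ∂P := by
  simp only [intervalIntegral.integral_of_le (NNReal.coe_nonneg T), ← integral_Icc_eq_integral_Ioc]
  exact (integral_integral_swap (f := fun u ω => F (u, ω))
    (hF.mono_measure (Measure.prod_mono le_rfl Measure.restrict_le_self))).symm

end Fubini

/-! ### Growth of means over a fixed event. -/

section Forward

variable {Ω : Type*} {mΩ : MeasurableSpace Ω} {P : Measure Ω} [SFinite P] {T : ℝ≥0}
  {r : ℝ → ℝ} {X Z : ℝ≥0 → Ω → ℝ}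

/-- If `Z` has constant mean over `A` after time `t`, then the solution `X` of `X = Z + ∫ X r` has
mean over `A` that grows at rate `r` after time `t`. -/
theorem integrable_and_setIntegral_eq_exp_mul (hr : IntervalIntegrable r volume 0 T)
    (hm : ∀ t ≤ T, Integrable (Z t) P)
    (hc : ∀ᵐ ω ∂P, ContinuousOn (fun t => Z t ω) (Set.Iic T)) {C : ℝ}
    (hC : ∀ t ≤ T, ∫ ω, |Z t ω| ∂P ≤ C)
    (hX : ∀ t ≤ T, ∀ᵐ ω ∂P, X t ω = Z t ω + ∫ u in (0 : ℝ)..t,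
      Z u.toNNReal ω * (r u * Real.exp (∫ v in u..t, r v))) {t : ℝ≥0} (ht : t ≤ T) :
    Integrable (X t) P ∧ ∀ A : Set Ω, (∀ u, t ≤ u → u ≤ T →
      ∫ ω in A, Z u ω ∂P = ∫ ω in A, Z t ω ∂P) →
      ∫ ω in A, X T ω ∂P = Real.exp (∫ u in (t : ℝ)..T, r u) * ∫ ω in A, X t ω ∂P := by
  have hrs : ∀ s ≤ T, IntervalIntegrable r volume 0 s := fun s hs => by
    simpa using hr.mono_nnreal (zero_le (a := T)) hs
  have hF : ∀ s ≤ T, Integrable (fun q : ℝ × Ω => Z q.1.toNNReal q.2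
      * (r q.1 * Real.exp (∫ v in q.1..s, r v))) (timeProd P s) := fun s hs =>
    integrable_mul_timeProd (fun u hu => hm u (hu.trans hs))
      (hc.mono fun ω h => h.mono (Set.Iic_subset_Iic.2 hs)) (fun u hu => hC u (hu.trans hs))
      (intervalIntegrable_mul_exp_integral (hrs s hs))
  refine ⟨((hm t ht).add (integrable_intervalIntegral_of_timeProd (hF t ht))).congr
    ((hX t ht).mono fun ω h => h.symm), fun A hA => ?_⟩
  let g : ℝ → ℝ := fun u => ∫ ω in A, Z u.toNNReal ω ∂P
  have hmean : ∀ s ≤ T, ∫ ω in A, X s ω ∂P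
      = g s + ∫ u in (0 : ℝ)..s, g u * (r u * Real.exp (∫ v in u..s, r v)) := by
    intro s hs
    rw [integral_congr_ae (ae_restrict_of_ae (hX s hs)), integral_add (hm s hs).integrableOn
      (integrable_intervalIntegral_of_timeProd (hF s hs)).integrableOn,
      setIntegral_intervalIntegral_swap (hF s hs)]
    simp only [integral_mul_const, g, Real.toNNReal_coe]
  have hgk : IntervalIntegrable (fun u => g u * (r u * Real.exp (∫ v in u..T, r v)))
      volume 0 T := by
    simpa only [integral_mul_const] using
      intervalIntegrable_setIntegral_of_timeProd (hF T le_rfl) A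
  -- Before `t` the kernel factors through time `t`; after `t`, `g` is constant and the kernel
  -- integrates explicitly.
  have h₁ : ∫ u in (0 : ℝ)..t, g u * (r u * Real.exp (∫ v in u..T, r v))
      = Real.exp (∫ u in (t : ℝ)..T, r u)
        * ∫ u in (0 : ℝ)..t, g u * (r u * Real.exp (∫ v in u..t, r v)) := by
    rw [← intervalIntegral.integral_const_mul]
    refine intervalIntegral.integral_congr fun u hu => ?_
    rw [Set.uIcc_of_le (NNReal.coe_nonneg t)] at hu
    have hut : IntervalIntegrable r volume u t := by
      simpa only [Real.coe_toNNReal _ hu.1] using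
        hr.mono_nnreal ((Real.toNNReal_le_iff_le_coe.2 hu.2).trans ht) ht
    simp only [← intervalIntegral.integral_add_adjacent_intervals hut (hr.mono_nnreal ht le_rfl),
      Real.exp_add]
    ring
  have h₂ : ∫ u in (t : ℝ)..T, g u * (r u * Real.exp (∫ v in u..T, r v))
      = g t * (Real.exp (∫ u in (t : ℝ)..T, r u) - 1) := by
    rw [← integral_mul_exp_integral (hr.mono_nnreal ht le_rfl),
      ← intervalIntegral.integral_const_mul]
    refine intervalIntegral.integral_congr fun u hu => ?_
    rw [Set.uIcc_of_le (NNReal.coe_le_coe.2 ht)] at hu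
    have : g u = g t := by
      simp only [g, Real.toNNReal_coe]
      exact hA _ (NNReal.le_toNNReal_of_coe_le hu.1) (Real.toNNReal_le_iff_le_coe.2 hu.2)
    simp only [this]
  have hgT : g T = g t := by
    simp only [g, Real.toNNReal_coe]
    exact hA T ht le_rfl
  have h0t := hgk.mono_nnreal (zero_le (a := T)) ht
  rw [NNReal.coe_zero] at h0t
  rw [hmean T le_rfl, hmean t ht,
    ← intervalIntegral.integral_add_adjacent_intervals h0t (hgk.mono_nnreal ht le_rfl),
    h₁, h₂, hgT]
  ring

end Forward

end DividendStock

/-! ### The forward price. -/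

theorem mainTheorem3 {Ω : Type*} {mΩ : MeasurableSpace Ω} (P : Measure Ω) [IsProbabilityMeasure P]
    (ℱ : Filtration ℝ≥0 mΩ) (W : ℝ≥0 → Ω → ℝ) (hW : DividendStock.IsBrownianWrt P ℱ W)
    (T : ℝ≥0) (r : ℝ → ℝ) (hr : IntervalIntegrable r volume 0 T)
    (n : ℕ) (τ : Fin n → ℝ≥0) (hτ : StrictMono τ) (hτ_pos : ∀ i, 0 < τ i) (hτ_lt : ∀ i, τ i < T)
    (D : Fin n → ℝ) (σ S : ℝ≥0 → Ω → ℝ)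
    (hS : DividendStock.IsStockPrice P ℱ W T r σ τ D S) (hS0 : Integrable (S 0) P) :
    Integrable (S T) P ∧
      ∀ t ≤ T, P[S T | ℱ t] =ᵐ[P] fun ω =>
        Real.exp (∫ u in (t : ℝ)..(T : ℝ), r u) * (S t ω + DividendStock.moneyAccount r τ D t)
          - DividendStock.moneyAccount r τ D T := by
  obtain ⟨M, hM, hsde⟩ := hS.sde
  have hX : ∀ t ≤ T, ∀ᵐ ω ∂P, S t ω + DividendStock.moneyAccount r τ D t
      = (S 0 ω + M t ω) + ∫ u in (0 : ℝ)..t,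
        (S 0 ω + M u.toNNReal ω) * (r u * Real.exp (∫ v in u..t, r v)) := by
    intro t ht
    filter_upwards [hS.cadlag, hM.continuous_paths, hsde, hS.jump_dividend, hS.jump_other]
      with ω h₁ h₂ h₃ h₄ h₅
    exact DividendStock.add_moneyAccount_eq hr h₁ h₂ h₃ h₄ h₅ ht
  have hC : ∀ t ≤ T, ∫ ω, |S 0 ω + M t ω| ∂P ≤ ∫ ω, |S 0 ω| ∂P + ∫ ω, |M T ω| ∂P := by
    intro t ht
    have hMt := hM.integrable ht
    -- The martingale property gives the `L¹` bound uniform in time that Fubini needs.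
    have hle : ∫ ω, |M t ω| ∂P ≤ ∫ ω, |M T ω| ∂P := by
      refine le_of_eq_of_le ?_ (integral_abs_condExp_le (m := ℱ t) (M T))
      exact integral_congr_ae ((hM.ae_eq_condExp hW ht).fun_comp abs)
    calc ∫ ω, |S 0 ω + M t ω| ∂P ≤ ∫ ω, |S 0 ω| + |M t ω| ∂P :=
          integral_mono (hS0.add hMt).abs (hS0.abs.add hMt.abs) fun ω => abs_add_le _ _
      _ = ∫ ω, |S 0 ω| ∂P + ∫ ω, |M t ω| ∂P := integral_add hS0.abs hMt.abs
      _ ≤ _ := by gcongr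
  have key : ∀ t ≤ T, _ := fun t ht => DividendStock.integrable_and_setIntegral_eq_exp_mul
    (X := fun t ω => S t ω + DividendStock.moneyAccount r τ D t) (Z := fun t ω => S 0 ω + M t ω)
    hr (fun t ht => hS0.add (hM.integrable ht))
    (hM.continuous_paths.mono fun ω h => continuousOn_const.add h) hC hX ht
  have hSint : ∀ t ≤ T, Integrable (S t) P := fun t ht => by
    simpa [Pi.sub_def] using (key t ht).1.sub (integrable_const (DividendStock.moneyAccount r τ D t))
  refine ⟨hSint T le_rfl, fun t ht => ?_⟩
  have hint : Integrable (fun ω => Real.exp (∫ u in (t : ℝ)..(T : ℝ), r u)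
      * (S t ω + DividendStock.moneyAccount r τ D t)) P := (key t ht).1.const_mul _
  refine (ae_eq_condExp_of_forall_setIntegral_eq (ℱ.le t) (hSint T le_rfl)
    (fun A _ _ => (hint.sub (integrable_const _)).integrableOn) (fun A hA _ => ?_) ?_).symm
  -- The means of `S 0 + M` over `A` in `ℱ t` do not change after `t`, so the growth formula
  -- applies.
  · have hA' := (key t ht).2 A fun u htu hu => by
      rw [integral_add hS0.integrableOn (hM.integrable hu).integrableOn,
        integral_add hS0.integrableOn (hM.integrable ht).integrableOn,
        hM.setIntegral_eq hW htu hu hA]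
    rw [integral_sub' hint.integrableOn (integrable_const _), integral_const_mul, ← hA',
      integral_add (hSint T le_rfl).integrableOn (integrable_const _)]
    ring
  · exact ((((hS.adapted t).add stronglyMeasurable_const).const_mul _).sub
      stronglyMeasurable_const).aestronglyMeasurable
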